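/- **Corollary 5.1 (Second order directional expansion).** Let $S(m)$ be the space of real symmetric $m\times m$ matrices, let $\Omega\subseteq\mathbb{R}^n$ be open (for instance a domain), and let $H\colon\Omega\to S(m)$ be $C^2$. For $x\in\Omega$ let $\lambda_1(x)\le\cdots\le\lambda_m(x)$ be the eigenvalues of $H(x)$, repeated according to multiplicity, let $P_i(x)$ be the orthogonal projection of $\mathbb{R}^m$ onto the eigenspace $\{\xi : H(x)\xi=\lambda_i(x)\xi\}$, let $d_i(x):=\operatorname{tr}P_i(x)$, and put $$A_j(x):=\sum_{\substack{1\le i\le m\\ \lambda_i(x)\neq\lambda_j(x)}}\frac{P_i(x)/d_i(x)}{\lambda_j(x)-\lambda_i(x)} .$$ For a matrix-valued function $F$ write $D_eF(x):=\lim_{h\to0}\frac{F(x+he)-F(x)}{h}$ for its derivative in the direction $e\in\mathbb{R}^n$, and $\nabla_qF(x)$ for the Jacobian matrix at $x$ of the vector-valued function $y\mapsto F(y)q$, where $q$ is a fixed vector. Let $j\in\{1,\dots,m\}$ and suppose that $d_j=\operatorname{tr}P_j$ is constant in $\Omega$. Then for every $x\in\Omega$, every $e\in\mathbb{R}^n$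 and every $\xi\in P_j(x)(\mathbb{R}^m)$ with $|\xi|=1$, $$\begin{aligned} \lambda_j(x+he) &=\xi^T\Big(\lambda_jI+hD_eH+\tfrac12h^2D_eD_eH+h^2D_eH\,A_j\,D_eH\Big)\xi+o(h^2)\\ &=\lambda_j+h\,\xi^T\nabla_\xi H\,e+\tfrac12h^2\,e^T\Big(\nabla_\xi(\nabla_\xi H)^T+2(\nabla_\xi H)^TA_j\nabla_\xi H\Big)e+o(h^2) \end{aligned}$$ as $h\to0$, and also $$\lambda_j(x+he)=\frac1{d_j}\operatorname{tr}\Big(P_j\big[\lambda_jI+hD_eH+\tfrac12h^2D_eD_eH+h^2D_eH\,A_j\,D_eH\big]\Big)+o(h^2)\qquad\text{as }h\to0,$$ where all functions on the right-hand sides are evaluated at $x$. -/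

import Mathlib

open Filter Topology Asymptotics
open scoped Matrix

-- Matrices carry the norm `‖X‖ = √(tr (Xᵀ X))`.
attribute [local instance] Matrix.frobeniusNormedAddCommGroup Matrix.frobeniusNormedSpace

namespace EigenExpansion

/-- The repeated eigenvalues `λ_0 ≤ ⋯ ≤ λ_{m-1}` of a symmetric real matrix in increasing order
(Mathlib's `eigenvalues₀` lists them in decreasing order). The value is `0` if `X` is not
symmetric. -/
noncomputable def eigval {m : ℕ} (X : Matrix (Fin m) (Fin m) ℝ) (j : Fin m) : ℝ :=
  open scoped Classical in
  if hX : X.IsHermitian then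
    hX.eigenvalues₀ (Fin.cast (Fintype.card_fin m).symm (Fin.rev j))
  else 0

/-- The eigenprojection `P_j`: the matrix of the orthogonal projection of `ℝ^m` onto the
eigenspace `{ξ | X ξ = λ_j ξ}`. -/
noncomputable def eigproj {m : ℕ} (X : Matrix (Fin m) (Fin m) ℝ) (j : Fin m) :
    Matrix (Fin m) (Fin m) ℝ :=
  (Matrix.toEuclideanCLM (n := Fin m) (𝕜 := ℝ)).symm
    (Module.End.eigenspace (Matrix.toEuclideanLin X) (eigval X j)).starProjection

/-- The matrix `A_j = ∑_{i : λ_i ≠ λ_j} (P_i / d_i) / (λ_j - λ_i)`, where `d_i = tr P_i`. -/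
noncomputable def pseudoinv {m : ℕ} (X : Matrix (Fin m) (Fin m) ℝ) (j : Fin m) :
    Matrix (Fin m) (Fin m) ℝ :=
  ∑ i : Fin m with eigval X i ≠ eigval X j,
    (eigval X j - eigval X i)⁻¹ • ((eigproj X i).trace)⁻¹ • eigproj X i

/-- The Jacobian matrix `∇f(x) ∈ ℝ^{k × n}` of a vector-valued function. -/
noncomputable def jacobian {n k : ℕ} (f : EuclideanSpace ℝ (Fin n) → Fin k → ℝ)
    (x : EuclideanSpace ℝ (Fin n)) : Matrix (Fin k) (Fin n) ℝ :=
  Matrix.of fun i l => fderiv ℝ f x (EuclideanSpace.single l 1) i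

/-- The Jacobian derivative `∇_q F(x) = ∇[F q](x) ∈ ℝ^{m × n}` of a matrix-valued function `F`
for a fixed vector `q`. -/
noncomputable def jacobianDeriv {n m k : ℕ}
    (F : EuclideanSpace ℝ (Fin n) → Matrix (Fin m) (Fin k) ℝ) (q : Fin k → ℝ)
    (x : EuclideanSpace ℝ (Fin n)) : Matrix (Fin m) (Fin n) ℝ :=
  jacobian (fun y => F y *ᵥ q) x

/-- The directional derivative `D_e F(x) = lim_{h → 0} (F(x + h e) - F(x)) / h`. -/
noncomputable def dirDeriv {n m k : ℕ} (e : EuclideanSpace ℝ (Fin n))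
    (F : EuclideanSpace ℝ (Fin n) → Matrix (Fin m) (Fin k) ℝ)
    (x : EuclideanSpace ℝ (Fin n)) : Matrix (Fin m) (Fin k) ℝ :=
  lineDeriv ℝ F x e

/-- The second order matrix
`λ_j I + h D_e H + ½ h² D_e D_e H + h² D_e H A_j D_e H`, evaluated at `x`. -/
noncomputable def expansionMatrix {n m : ℕ}
    (H : EuclideanSpace ℝ (Fin n) → Matrix (Fin m) (Fin m) ℝ) (j : Fin m)
    (x e : EuclideanSpace ℝ (Fin n)) (h : ℝ) : Matrix (Fin m) (Fin m) ℝ :=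
  eigval (H x) j • (1 : Matrix (Fin m) (Fin m) ℝ) + h • dirDeriv e H x
    + ((1 / 2 : ℝ) * h ^ 2) • dirDeriv e (dirDeriv e H) x
    + h ^ 2 • (dirDeriv e H x * pseudoinv (H x) j * dirDeriv e H x)

end EigenExpansion

namespace EigenExpansion

open scoped RealInnerProductSpace

/-! ### Perturbation of an eigenvalue of constant multiplicity. -/

section Perturbation

variable {E : Type*} [NormedAddCommGroup E] [InnerProductSpace ℝ E]

/-! Along the line `x + h • e` write T for H, l for its `j`-th eigenvalue, T₀ and l₀ for their
values at `h = 0`, T₁ for the directional derivative, P for the projection onto the eigenspace K of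
T₀. Since A inverts l₀ - T₀ up to P, an eigenvector v of T for l satisfies v - Pv = A((T - T₀)v - (l
- l₀)v). For small h the right side has norm at most ‖v‖/2, so P is injective on the moving
eigenspace; constant multiplicity makes it onto K. Hence each unit ξ in K is Pv for such a v
(`exists_eigenvector_projection_eq`).

Pairing Tv = lv with ξ gives l - l₀ = ⟪ξ, (T - T₀)v⟫, and since Aξ = 0 the equation for v yields v =
ξ + h A T₁ ξ + O(h²). Substitution gives the expansion (`eigenvalue_expansion`). Only continuity of
l is needed beforehand, not differentiability of eigenvalues or eigenvectors; it comes from Weyl's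
inequality (`abs_eigval_sub_le`). The properties of A are read off on an eigenbasis
(`pseudoinv_eigenbasis`), and T is expanded by `taylor_two_line`. The Jacobian form is a rewriting;
the trace form averages over an orthonormal basis of K. -/

lemma isBigO_clm_apply {F : Type*} [NormedAddCommGroup F] [NormedSpace ℝ F]
    {α : Type*} {l : Filter α} {T : α → E →L[ℝ] F} {v : α → E} {f g : α → ℝ}
    (hT : T =O[l] f) (hv : v =O[l] g) : (fun a => T a (v a)) =O[l] fun a => f a * g a :=
  (IsBigO.of_bound 1 (by
    filter_upwards with a
    simpa using (T a).le_opNorm (v a))).trans (hT.norm_left.mul hv.norm_left)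

/-- If `A` inverts `l₀ - T₀` up to the eigenprojection of `T₀`, and `S` is close to `T₀`, `l` is
close to `l₀`, then the eigenspace projection of `T₀` maps the eigenspace of `S` onto that of `T₀`
as soon as they have the same dimension. -/
lemma exists_eigenvector_projection_eq [FiniteDimensional ℝ E] {T₀ S A : E →L[ℝ] E} {l₀ l : ℝ}
    (hA : ∀ v, A (l₀ • v - T₀ v)
      = v - (Module.End.eigenspace (T₀ : E →ₗ[ℝ] E) l₀).starProjection v)
    (hsmall : ‖A‖ * (‖S - T₀‖ + |l - l₀|) ≤ 1 / 2)
    (hdim : Module.finrank ℝ (Module.End.eigenspace (S : E →ₗ[ℝ] E) l)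
      = Module.finrank ℝ (Module.End.eigenspace (T₀ : E →ₗ[ℝ] E) l₀))
    {ξ : E} (hξ : ξ ∈ Module.End.eigenspace (T₀ : E →ₗ[ℝ] E) l₀) :
    ∃ v, (v - ξ = A ((S - T₀) v - (l - l₀) • v)) ∧ S v = l • v ∧
      (Module.End.eigenspace (T₀ : E →ₗ[ℝ] E) l₀).starProjection v = ξ ∧ ‖v‖ ≤ 2 * ‖ξ‖ := by
  set K := Module.End.eigenspace (T₀ : E →ₗ[ℝ] E) l₀ with hK
  set K' := Module.End.eigenspace (S : E →ₗ[ℝ] E) l with hK'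
  have hmem : ∀ v ∈ K', S v = l • v := fun v hv => by
    simpa using Module.End.mem_eigenspace_iff.1 hv
  have key : ∀ v ∈ K', v - K.starProjection v = A ((S - T₀) v - (l - l₀) • v) := by
    intro v hv
    rw [← hA v]
    congr 1
    rw [_root_.sub_apply, hmem v hv, sub_smul]
    abel
  have bound : ∀ v ∈ K', ‖v‖ ≤ 2 * ‖K.starProjection v‖ := by
    intro v hv
    have h1 : ‖v - K.starProjection v‖ ≤ 1 / 2 * ‖v‖ := by
      rw [key v hv]
      calc ‖A ((S - T₀) v - (l - l₀) • v)‖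
          ≤ ‖A‖ * ‖(S - T₀) v - (l - l₀) • v‖ := A.le_opNorm _
        _ ≤ ‖A‖ * (‖S - T₀‖ * ‖v‖ + |l - l₀| * ‖v‖) := by
          gcongr
          refine (norm_sub_le _ _).trans ?_
          rw [norm_smul, Real.norm_eq_abs]
          gcongr
          exact (S - T₀).le_opNorm v
        _ = ‖A‖ * (‖S - T₀‖ + |l - l₀|) * ‖v‖ := by ring
        _ ≤ 1 / 2 * ‖v‖ := by gcongr
    have h2 : ‖v‖ ≤ ‖v - K.starProjection v‖ + ‖K.starProjection v‖ := by
      simpa using norm_add_le (v - K.starProjection v) (K.starProjection v)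
    linarith
  let f : K' →ₗ[ℝ] K := (K.orthogonalProjectionOnto : E →ₗ[ℝ] K).comp K'.subtype
  have hf : ∀ v : K', ((f v : K) : E) = K.starProjection v := fun v => rfl
  -- The bound forces `v = 0` when its projection vanishes; equal dimensions then give surjectivity.
  have hinj : Function.Injective f := by
    rw [injective_iff_map_eq_zero]
    intro v hv
    have h1 := bound v v.2
    rw [← hf, hv] at h1
    simpa using h1
  obtain ⟨v, hv⟩ := (LinearMap.injective_iff_surjective_of_finrank_eq_finrank hdim).1 hinj ⟨ξ, hξ⟩
  have hPv : K.starProjection (v : E) = ξ := by rw [← hf, hv]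
  refine ⟨v, ?_, hmem v v.2, hPv, ?_⟩
  · rw [← key v v.2, hPv]
  · rw [← hPv]; exact bound v v.2

/-- Second order expansion of an eigenvalue of constant multiplicity. -/
theorem eigenvalue_expansion [FiniteDimensional ℝ E] {T : ℝ → E →L[ℝ] E} {T₀ T₁ T₂ A : E →L[ℝ] E}
    {l : ℝ → ℝ} {l₀ : ℝ}
    (hT : (fun h => T h - (T₀ + h • T₁ + ((1 / 2 : ℝ) * h ^ 2) • T₂)) =o[𝓝 0] fun h : ℝ => h ^ 2)
    (hsymm : (T₀ : E →ₗ[ℝ] E).IsSymmetric) (hl : Tendsto l (𝓝 0) (𝓝 l₀))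
    (hA : ∀ v, A (l₀ • v - T₀ v)
      = v - (Module.End.eigenspace (T₀ : E →ₗ[ℝ] E) l₀).starProjection v)
    (hAK : ∀ v ∈ Module.End.eigenspace (T₀ : E →ₗ[ℝ] E) l₀, A v = 0)
    (hdim : ∀ᶠ h in 𝓝 0, Module.finrank ℝ (Module.End.eigenspace (T h : E →ₗ[ℝ] E) (l h))
      = Module.finrank ℝ (Module.End.eigenspace (T₀ : E →ₗ[ℝ] E) l₀))
    {ξ : E} (hξ : ξ ∈ Module.End.eigenspace (T₀ : E →ₗ[ℝ] E) l₀) (hξ1 : ⟪ξ, ξ⟫ = 1) :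
    (fun h => l h - (l₀ + h * ⟪ξ, T₁ ξ⟫ + (1 / 2 : ℝ) * h ^ 2 * ⟪ξ, T₂ ξ⟫
      + h ^ 2 * ⟪ξ, T₁ (A (T₁ ξ))⟫)) =o[𝓝 0] fun h : ℝ => h ^ 2 := by
  have hid : (fun h : ℝ => h) =O[𝓝 0] fun h : ℝ => h := isBigO_refl _ _
  have hle : (fun h : ℝ => h ^ 2) =O[𝓝 0] fun h : ℝ => h :=
    (isLittleO_pow_id one_lt_two).isBigO
  have hid0 : (fun h : ℝ => h) =o[𝓝 0] fun _ : ℝ => (1 : ℝ) :=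
    (isLittleO_one_iff ℝ).2 tendsto_id
  have hD2 : (fun h => T h - T₀ - h • T₁) =O[𝓝 0] fun h : ℝ => h ^ 2 := by
    have h1 : (fun h : ℝ => ((1 / 2 : ℝ) * h ^ 2) • T₂) =O[𝓝 0] fun h : ℝ => h ^ 2 :=
      IsBigO.of_bound (1 / 2 * ‖T₂‖) (by
        filter_upwards with h
        rw [norm_smul, norm_mul, Real.norm_of_nonneg (by norm_num : (0 : ℝ) ≤ 1 / 2)]
        exact le_of_eq (by ring))
    refine (hT.isBigO.add h1).congr_left fun h => by abel
  have hD1 : (fun h => T h - T₀) =O[𝓝 0] fun h : ℝ => h := by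
    have h1 : (fun h : ℝ => h • T₁) =O[𝓝 0] fun h : ℝ => h :=
      IsBigO.of_bound ‖T₁‖ (by
        filter_upwards with h
        rw [norm_smul]
        exact le_of_eq (by ring))
    refine ((hD2.trans hle).add h1).congr_left fun h => by abel
  have hD0 : Tendsto (fun h => ‖T h - T₀‖) (𝓝 0) (𝓝 0) :=
    tendsto_zero_iff_norm_tendsto_zero.1 ((isLittleO_one_iff ℝ).1 (hD1.trans_isLittleO hid0))
  have hl0 : Tendsto (fun h => |l h - l₀|) (𝓝 0) (𝓝 0) := by
    simpa using (hl.sub_const l₀).abs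
  have hsmall : ∀ᶠ h in 𝓝 0, ‖A‖ * (‖T h - T₀‖ + |l h - l₀|) ≤ 1 / 2 := by
    have h1 : Tendsto (fun h => ‖A‖ * (‖T h - T₀‖ + |l h - l₀|)) (𝓝 0) (𝓝 0) := by
      simpa using (hD0.add hl0).const_mul ‖A‖
    exact h1.eventually_le_const (by norm_num)
  obtain ⟨v, hv⟩ := ((hsmall.and hdim).mono fun h hh =>
    exists_eigenvector_projection_eq hA hh.1 hh.2 hξ).choice
  have hξT : T₀ ξ = l₀ • ξ := by simpa using Module.End.mem_eigenspace_iff.1 hξ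
  have hAξ : A ξ = 0 := hAK ξ hξ
  have hv1 : v =O[𝓝 0] fun _ : ℝ => (1 : ℝ) :=
    IsBigO.of_bound (2 * ‖ξ‖) (hv.mono fun h hh => by simpa using hh.2.2.2)
  have hc1 : ∀ w : E, (fun _ : ℝ => w) =O[𝓝 (0 : ℝ)] fun _ : ℝ => (1 : ℝ) := fun w =>
    isBigO_const_const w one_ne_zero _
  have hinner : ∀ {w : ℝ → E} {g : ℝ → ℝ}, w =O[𝓝 0] g → (fun h => ⟪ξ, w h⟫) =O[𝓝 0] g :=
    fun {w g} hw => (innerSL ℝ ξ).isBigO_comp w (𝓝 0) |>.trans hw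
  -- Symmetry of `T₀` removes the unknown `v h`: its projection is `ξ`, so it pairs to 1 with `ξ`.
  have hδ : ∀ᶠ h in 𝓝 0, l h - l₀ = ⟪ξ, (T h - T₀) (v h)⟫ := hv.mono fun h hh => by
    have h1 : ⟪ξ, v h⟫ = 1 := by
      rw [← hξ1]
      nth_rewrite 1 [← Submodule.starProjection_eq_self_iff.2 hξ]
      rw [Submodule.inner_starProjection_left_eq_right, hh.2.2.1]
    have h2 : ⟪ξ, T₀ (v h)⟫ = l₀ := by
      have := hsymm ξ (v h)
      simp only [ContinuousLinearMap.coe_coe] at this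
      rw [← this, hξT, inner_smul_left, h1]
      simp
    rw [_root_.sub_apply, inner_sub_right, h2, hh.2.1, inner_smul_right, h1, mul_one]
  have hδ1 : (fun h => l h - l₀) =O[𝓝 0] fun h : ℝ => h := by
    refine IsBigO.congr' (hinner (isBigO_clm_apply hD1 hv1)) (hδ.mono fun h hh => hh.symm) ?_
    simp
  have hvξ : (fun h => v h - ξ) =O[𝓝 0] fun h : ℝ => h := by
    have h1 : (fun h => (T h - T₀) (v h) - (l h - l₀) • v h) =O[𝓝 0] fun h : ℝ => h := by
      simpa using (isBigO_clm_apply hD1 hv1).sub (hδ1.smul hv1)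
    exact (A.isBigO_comp _ _ |>.trans h1).congr' (hv.mono fun h hh => hh.1.symm) EventuallyEq.rfl
  -- As `A ξ = 0`, the term with `l h - l₀` only sees `A (v h - ξ)`, so it is a product of two O(h)
  -- factors.
  have hr : (fun h => v h - ξ - h • A (T₁ ξ)) =O[𝓝 0] fun h : ℝ => h ^ 2 := by
    have h1 : (fun h => A ((T h - T₀) (v h - ξ) + (T h - T₀ - h • T₁) ξ) -
        (l h - l₀) • A (v h - ξ)) =O[𝓝 0] fun h : ℝ => h ^ 2 := by
      have h2 := isBigO_clm_apply hD1 hvξ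
      have h3 := isBigO_clm_apply hD2 (hc1 ξ)
      have h4 := hδ1.smul (A.isBigO_comp _ _ |>.trans hvξ)
      simp only [mul_one, smul_eq_mul, ← sq] at h2 h3 h4
      exact (A.isBigO_comp _ _ |>.trans (h2.add h3)).sub h4
    refine h1.congr' (hv.mono fun h hh => ?_) EventuallyEq.rfl
    have h2 := hh.1
    simp only [map_sub, map_add, map_smul, hAξ, _root_.sub_apply, _root_.smul_apply] at h2 ⊢
    rw [h2]
    module
  -- The exact error once `v h = ξ + h • A (T₁ ξ) + O(h²)` is inserted in `hδ`: a Taylor remainder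
  -- plus two terms of order h³.
  have hmain : (fun h => ⟪ξ, (T h - (T₀ + h • T₁ + ((1 / 2 : ℝ) * h ^ 2) • T₂)) ξ⟫
      + (h * ⟪ξ, (T h - T₀ - h • T₁) (A (T₁ ξ))⟫
        + ⟪ξ, (T h - T₀) (v h - ξ - h • A (T₁ ξ))⟫)) =o[𝓝 0] fun h : ℝ => h ^ 2 := by
    have h1 : (fun h => (T h - (T₀ + h • T₁ + ((1 / 2 : ℝ) * h ^ 2) • T₂)) ξ)
        =o[𝓝 0] fun h : ℝ => h ^ 2 :=
      (ContinuousLinearMap.apply ℝ E ξ).isBigO_comp _ _ |>.trans_isLittleO hT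
    have h2 := hid.mul (hinner (isBigO_clm_apply hD2 (hc1 (A (T₁ ξ)))))
    have h3 := hinner (isBigO_clm_apply hD1 hr)
    have h4 : (fun h : ℝ => h * h ^ 2) =o[𝓝 0] fun h : ℝ => h ^ 2 := by
      simpa using hid0.mul_isBigO (isBigO_refl (fun h : ℝ => h ^ 2) (𝓝 0))
    simp only [mul_one] at h2
    exact ((innerSL ℝ ξ).isBigO_comp _ _ |>.trans_isLittleO h1).add
      ((h2.add h3).trans_isLittleO h4)
  refine hmain.congr' (hδ.mono fun h hh => ?_) EventuallyEq.rfl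
  simp only [map_sub, map_smul, _root_.sub_apply, _root_.add_apply, _root_.smul_apply,
    inner_sub_right, inner_add_right, inner_smul_right] at hh ⊢
  linear_combination -hh

end Perturbation

/-! ### Ordered eigenvalues, eigenprojections and the reduced resolvent. -/

section Spectral

variable {m : ℕ} {X Y : Matrix (Fin m) (Fin m) ℝ}

/-- The operator on Euclidean space attached to a matrix. -/
noncomputable abbrev toOp (X : Matrix (Fin m) (Fin m) ℝ) :
    EuclideanSpace ℝ (Fin m) →L[ℝ] EuclideanSpace ℝ (Fin m) :=
  Matrix.toEuclideanCLM (n := Fin m) (𝕜 := ℝ) X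

lemma eigval_monotone (hX : X.IsHermitian) : Monotone (eigval X) := by
  intro i j hij
  simp only [eigval, dif_pos hX]
  exact hX.eigenvalues₀_antitone (Fin.rev_le_rev.2 hij)

lemma exists_eigenbasis (hX : X.IsHermitian) :
    ∃ b : OrthonormalBasis (Fin m) ℝ (EuclideanSpace ℝ (Fin m)),
      ∀ k, toOp X (b k) = eigval X k • b k := by
  -- The reversal turns decreasing order into increasing; the last factor is the enumeration built
  -- into `Matrix.IsHermitian.eigenvalues`.
  let σ : Fin m ≃ Fin m := Fin.revPerm.trans ((finCongr (Fintype.card_fin m).symm).trans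
    (Fintype.equivOfCardEq (Fintype.card_fin _)))
  refine ⟨hX.eigenvectorBasis.reindex σ.symm, fun k => ?_⟩
  have h1 : eigval X k = hX.eigenvalues (σ k) := by
    simp only [eigval, dif_pos hX, Matrix.IsHermitian.eigenvalues, σ]
    congr 1
    simp
  rw [OrthonormalBasis.reindex_apply, Equiv.symm_symm, h1]
  ext i
  simpa using congrFun (hX.mulVec_eigenvectorBasis (σ k)) i

/-- Courant–Fischer argument: the span of the eigenvectors of `X` with index at least `j` and that
of the eigenvectors of `Y` with index at most `j` share a nonzero vector `u`, on which the two
quadratic forms are compared. -/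
lemma eigval_le_add (hX : X.IsHermitian) (hY : Y.IsHermitian) (j : Fin m) :
    eigval X j ≤ eigval Y j + ‖toOp X - toOp Y‖ := by
  obtain ⟨b, hb⟩ := exists_eigenbasis hX
  obtain ⟨c, hc⟩ := exists_eigenbasis hY
  let U : Submodule ℝ (EuclideanSpace ℝ (Fin m)) :=
    Submodule.span ℝ (Set.range fun k : Finset.Ici j => b k)
  let V : Submodule ℝ (EuclideanSpace ℝ (Fin m)) :=
    Submodule.span ℝ (Set.range fun k : Finset.Iic j => c k)
  have hU : Module.finrank ℝ U = m - j := by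
    refine (finrank_span_eq_card
      (b.orthonormal.linearIndependent.comp _ Subtype.val_injective)).trans ?_
    rw [Fintype.card_coe, Fin.card_Ici]
  have hV : Module.finrank ℝ V = j + 1 := by
    refine (finrank_span_eq_card
      (c.orthonormal.linearIndependent.comp _ Subtype.val_injective)).trans ?_
    rw [Fintype.card_coe, Fin.card_Iic]
  -- The dimensions `m - j` and `j + 1` (indices start at 0) add up to `m + 1`.
  have hne : U ⊓ V ≠ ⊥ := by
    intro h0
    have h1 := Submodule.finrank_sup_add_finrank_inf_eq U V
    have h2 := (U ⊔ V).finrank_le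
    rw [h0, finrank_bot, hU, hV] at h1
    rw [finrank_euclideanSpace_fin] at h2
    have := j.2
    omega
  obtain ⟨u, hu, hu0⟩ := Submodule.exists_mem_ne_zero_of_ne_bot hne
  have hbu : ∀ k < j, ⟪b k, u⟫ = 0 := by
    intro k hk
    have : U ≤ (ℝ ∙ b k)ᗮ := by
      rw [Submodule.span_le]
      rintro _ ⟨l, rfl⟩
      rw [SetLike.mem_coe, Submodule.mem_orthogonal_singleton_iff_inner_right]
      have hl : j ≤ l := Finset.mem_Ici.1 l.2
      exact b.orthonormal.2 (by omega)
    exact Submodule.mem_orthogonal_singleton_iff_inner_right.1 (this hu.1)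
  have hcu : ∀ k > j, ⟪c k, u⟫ = 0 := by
    intro k hk
    have : V ≤ (ℝ ∙ c k)ᗮ := by
      rw [Submodule.span_le]
      rintro _ ⟨l, rfl⟩
      rw [SetLike.mem_coe, Submodule.mem_orthogonal_singleton_iff_inner_right]
      have hl : l ≤ j := Finset.mem_Iic.1 l.2
      exact c.orthonormal.2 (by omega)
    exact Submodule.mem_orthogonal_singleton_iff_inner_right.1 (this hu.2)
  have hquad : ∀ (Z : Matrix (Fin m) (Fin m) ℝ)
      (f : OrthonormalBasis (Fin m) ℝ (EuclideanSpace ℝ (Fin m))),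
      (∀ k, toOp Z (f k) = eigval Z k • f k) →
      ⟪u, toOp Z u⟫ = ∑ k, eigval Z k * ⟪f k, u⟫ ^ 2 := by
    intro Z f hf
    conv_lhs => rw [← f.sum_repr' u, map_sum, f.sum_repr' u]
    rw [inner_sum]
    refine Finset.sum_congr rfl fun k _ => ?_
    rw [map_smul, hf, inner_smul_right, inner_smul_right, real_inner_comm]
    ring
  have hnorm : ∀ f : OrthonormalBasis (Fin m) ℝ (EuclideanSpace ℝ (Fin m)),
      ‖u‖ ^ 2 = ∑ k, ⟪f k, u⟫ ^ 2 := fun f => by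
    simpa using (f.sum_sq_norm_inner_right u).symm
  have h1 : eigval X j * ‖u‖ ^ 2 ≤ ⟪u, toOp X u⟫ := by
    rw [hquad X b hb, hnorm b, Finset.mul_sum]
    refine Finset.sum_le_sum fun k _ => ?_
    rcases lt_or_ge k j with hk | hk
    · simp [hbu k hk]
    · exact mul_le_mul_of_nonneg_right (eigval_monotone hX hk) (sq_nonneg _)
  have h2 : ⟪u, toOp Y u⟫ ≤ eigval Y j * ‖u‖ ^ 2 := by
    rw [hquad Y c hc, hnorm c, Finset.mul_sum]
    refine Finset.sum_le_sum fun k _ => ?_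
    rcases lt_or_ge j k with hk | hk
    · simp [hcu k hk]
    · exact mul_le_mul_of_nonneg_right (eigval_monotone hY hk) (sq_nonneg _)
  have h3 : ⟪u, toOp X u⟫ - ⟪u, toOp Y u⟫ ≤ ‖toOp X - toOp Y‖ * ‖u‖ ^ 2 := by
    rw [← inner_sub_right, ← _root_.sub_apply]
    refine (real_inner_le_norm _ _).trans ?_
    have := (toOp X - toOp Y).le_opNorm u
    nlinarith [norm_nonneg u]
  have hpos : 0 < ‖u‖ ^ 2 := by positivity
  refine le_of_mul_le_mul_right ?_ hpos
  linarith

/-- **Weyl's inequality**: eigenvalues are Lipschitz with respect to the operator norm. -/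
lemma abs_eigval_sub_le (hX : X.IsHermitian) (hY : Y.IsHermitian) (j : Fin m) :
    |eigval X j - eigval Y j| ≤ ‖toOp X - toOp Y‖ := by
  rw [abs_sub_le_iff]
  have h1 := eigval_le_add hX hY j
  have h2 := eigval_le_add hY hX j
  rw [norm_sub_rev] at h2
  constructor <;> linarith

/-- The eigenspace of `X` for the `j`-th eigenvalue. -/
noncomputable abbrev eigsp (X : Matrix (Fin m) (Fin m) ℝ) (j : Fin m) :
    Submodule ℝ (EuclideanSpace ℝ (Fin m)) :=
  Module.End.eigenspace
    (toOp X : EuclideanSpace ℝ (Fin m) →ₗ[ℝ] EuclideanSpace ℝ (Fin m)) (eigval X j)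

lemma toOp_eigproj (X : Matrix (Fin m) (Fin m) ℝ) (j : Fin m) :
    toOp (eigproj X j) = (eigsp X j).starProjection :=
  StarAlgEquiv.apply_symm_apply _ _

lemma trace_eq_trace_toOp (X : Matrix (Fin m) (Fin m) ℝ) :
    X.trace = LinearMap.trace ℝ _
      (toOp X : EuclideanSpace ℝ (Fin m) →ₗ[ℝ] EuclideanSpace ℝ (Fin m)) := by
  rw [toOp, Matrix.coe_toEuclideanCLM_eq_toEuclideanLin, Matrix.toEuclideanLin, Matrix.toLpLin_eq_toLin]
  exact (Matrix.trace_toLin_eq _ _).symm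

lemma trace_eigproj (X : Matrix (Fin m) (Fin m) ℝ) (j : Fin m) :
    (eigproj X j).trace = Module.finrank ℝ (eigsp X j) := by
  rw [trace_eq_trace_toOp, toOp_eigproj]
  refine LinearMap.IsProj.trace (p := eigsp X j) ⟨fun v => ?_, fun v hv => ?_⟩
  · exact Submodule.starProjection_apply_mem _ v
  · exact Submodule.starProjection_eq_self_iff.2 hv

lemma mem_eigsp_iff {j : Fin m} {v : EuclideanSpace ℝ (Fin m)} :
    v ∈ eigsp X j ↔ toOp X v = eigval X j • v := by
  simp [eigsp]

section Eigenbasis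

variable {b : OrthonormalBasis (Fin m) ℝ (EuclideanSpace ℝ (Fin m))}

lemma starProjection_eigenbasis (hX : X.IsHermitian) (hb : ∀ k, toOp X (b k) = eigval X k • b k)
    (i k : Fin m) :
    (eigsp X i).starProjection (b k) = if eigval X i = eigval X k then b k else 0 := by
  split_ifs with h
  · rw [Submodule.starProjection_eq_self_iff, mem_eigsp_iff, hb, h]
  · rw [Submodule.starProjection_apply_eq_zero_iff, Submodule.mem_orthogonal]
    intro w hw
    rw [mem_eigsp_iff] at hw
    have hs : ⟪toOp X w, b k⟫ = ⟪w, toOp X (b k)⟫ :=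
      (Matrix.isSymmetric_toEuclideanLin_iff.2 hX) w (b k)
    rw [hw, hb, inner_smul_left, inner_smul_right] at hs
    have : (eigval X i - eigval X k) * ⟪w, b k⟫ = 0 := by
      simp only [conj_trivial] at hs
      linarith
    exact (mul_eq_zero.1 this).resolve_left (sub_ne_zero.2 h)

lemma trace_eigproj_eq_card (hX : X.IsHermitian)
    (hb : ∀ k, toOp X (b k) = eigval X k • b k) (i : Fin m) :
    (eigproj X i).trace = (Finset.univ.filter fun k => eigval X i = eigval X k).card := by
  rw [trace_eq_trace_toOp, toOp_eigproj, LinearMap.trace_eq_sum_inner _ b]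
  simp only [ContinuousLinearMap.coe_coe, starProjection_eigenbasis hX hb]
  rw [Finset.card_filter, Nat.cast_sum]
  refine Finset.sum_congr rfl fun k _ => ?_
  split_ifs <;> simp

/-- The sum runs over repeated eigenvalues, so each eigenprojection occurs as often as its rank;
division by the trace undoes this. On the `j`-th eigenspace both sides vanish, the right one because
`0⁻¹ = 0`. -/
lemma pseudoinv_eigenbasis (hX : X.IsHermitian) (hb : ∀ k, toOp X (b k) = eigval X k • b k)
    (j k : Fin m) :
    toOp (pseudoinv X j) (b k) = (eigval X j - eigval X k)⁻¹ • b k := by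
  have hsum : toOp (pseudoinv X j) (b k) = ∑ i with eigval X i ≠ eigval X j,
      (eigval X j - eigval X i)⁻¹ • ((eigproj X i).trace)⁻¹ •
        (if eigval X i = eigval X k then b k else 0) := by
    simp only [← starProjection_eigenbasis hX hb, ← toOp_eigproj]
    simp [pseudoinv, toOp, map_sum, map_smul]
  rw [hsum]
  by_cases hk : eigval X k = eigval X j
  · rw [hk, sub_self, inv_zero, zero_smul]
    refine Finset.sum_eq_zero fun i hi => ?_
    rw [if_neg (Finset.mem_filter.1 hi).2, smul_zero, smul_zero]
  · have hcard : ((Finset.univ.filter fun i => eigval X k = eigval X i).card : ℝ) ≠ 0 := by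
      rw [Nat.cast_ne_zero]
      exact Finset.card_ne_zero_of_mem (Finset.mem_filter.2 ⟨Finset.mem_univ k, rfl⟩)
    have : ∀ i ∈ Finset.univ.filter (fun i => eigval X i ≠ eigval X j),
        (eigval X j - eigval X i)⁻¹ • ((eigproj X i).trace)⁻¹ •
          (if eigval X i = eigval X k then b k else 0)
        = if eigval X k = eigval X i then (eigval X j - eigval X k)⁻¹ •
          ((Finset.univ.filter fun i => eigval X k = eigval X i).card : ℝ)⁻¹ • b k else 0 := by
      intro i _
      by_cases h : eigval X k = eigval X i
      · rw [trace_eigproj_eq_card hX hb, if_pos h.symm, if_pos h, h]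
      · rw [if_neg (Ne.symm h), if_neg h, smul_zero, smul_zero]
    rw [Finset.sum_congr rfl this, ← Finset.sum_filter, Finset.filter_filter, Finset.sum_const,
      ← Nat.cast_smul_eq_nsmul ℝ]
    have hf : (Finset.univ.filter fun i => eigval X i ≠ eigval X j ∧ eigval X k = eigval X i)
        = Finset.univ.filter fun i => eigval X k = eigval X i := by
      ext i
      simp only [Finset.mem_filter, Finset.mem_univ, true_and, and_iff_right_iff_imp]
      intro h
      rwa [← h]
    rw [hf, smul_comm, smul_inv_smul₀ hcard]

end Eigenbasis

/-- `A_j` inverts `λ_j - X` up to the eigenprojection `P_j`. -/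
lemma pseudoinv_apply_sub (hX : X.IsHermitian) (j : Fin m) (v : EuclideanSpace ℝ (Fin m)) :
    toOp (pseudoinv X j) (eigval X j • v - toOp X v) = v - (eigsp X j).starProjection v := by
  obtain ⟨b, hb⟩ := exists_eigenbasis hX
  have : (toOp (pseudoinv X j)).comp (eigval X j • ContinuousLinearMap.id ℝ _ - toOp X)
      = ContinuousLinearMap.id ℝ _ - (eigsp X j).starProjection := by
    refine ContinuousLinearMap.coe_injective (b.toBasis.ext fun k => ?_)
    simp only [OrthonormalBasis.coe_toBasis, ContinuousLinearMap.coe_coe,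
      ContinuousLinearMap.comp_apply, _root_.sub_apply, _root_.smul_apply,
      ContinuousLinearMap.id_apply, hb, starProjection_eigenbasis hX hb, ← sub_smul, map_smul,
      pseudoinv_eigenbasis hX hb]
    split_ifs with h
    · simp [h]
    · rw [smul_smul, mul_inv_cancel₀ (sub_ne_zero.2 h), one_smul, sub_zero]
  simpa using congrArg (fun f => f v) this

lemma pseudoinv_apply_eq_zero (hX : X.IsHermitian) (j : Fin m) {v : EuclideanSpace ℝ (Fin m)}
    (hv : v ∈ eigsp X j) : toOp (pseudoinv X j) v = 0 := by
  obtain ⟨b, hb⟩ := exists_eigenbasis hX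
  have : (toOp (pseudoinv X j)).comp (eigsp X j).starProjection = 0 := by
    refine ContinuousLinearMap.coe_injective (b.toBasis.ext fun k => ?_)
    simp only [OrthonormalBasis.coe_toBasis, ContinuousLinearMap.coe_coe,
      ContinuousLinearMap.comp_apply, starProjection_eigenbasis hX hb]
    split_ifs with h
    · simp [pseudoinv_eigenbasis hX hb, h]
    · simp
  simpa [Submodule.starProjection_eq_self_iff.2 hv] using congrArg (fun f => f v) this

end Spectral

/-! ### Second order Taylor expansion along a line. -/

section Calculus

variable {E F : Type*} [NormedAddCommGroup E] [NormedSpace ℝ E]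
  [NormedAddCommGroup F] [NormedSpace ℝ F] {f : E → F} {x : E}

lemma eventually_differentiableAt (hf : ContDiffAt ℝ 2 f x) :
    ∀ᶠ y in 𝓝 x, DifferentiableAt ℝ f y :=
  (hf.eventually (by simp)).mono fun _ hy => hy.differentiableAt (by simp)

lemma differentiableAt_fderiv_apply (hf : ContDiffAt ℝ 2 f x) (w : E) :
    DifferentiableAt ℝ (fun y => fderiv ℝ f y w) x :=
  ((hf.fderiv_right (m := 1) (by norm_num)).differentiableAt (by simp)).clm_apply
    (differentiableAt_const w)

lemma lineDeriv_eventuallyEq (hf : ContDiffAt ℝ 2 f x) (e : E) :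
    (fun y => lineDeriv ℝ f y e) =ᶠ[𝓝 x] fun y => fderiv ℝ f y e :=
  (eventually_differentiableAt hf).mono fun _ hy => hy.lineDeriv_eq_fderiv

lemma lineDeriv_lineDeriv (hf : ContDiffAt ℝ 2 f x) (e : E) :
    lineDeriv ℝ (fun y => lineDeriv ℝ f y e) x e = fderiv ℝ (fun y => fderiv ℝ f y e) x e := by
  rw [(lineDeriv_eventuallyEq hf e).lineDeriv_eq,
    (differentiableAt_fderiv_apply hf e).lineDeriv_eq_fderiv]

/-- Second order Taylor expansion along a line. -/
lemma taylor_two_line (hf : ContDiffAt ℝ 2 f x) (e : E) :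
    (fun h : ℝ => f (x + h • e) - (f x + h • lineDeriv ℝ f x e
      + ((1 / 2 : ℝ) * h ^ 2) • lineDeriv ℝ (fun y => lineDeriv ℝ f y e) x e))
      =o[𝓝 0] fun h : ℝ => h ^ 2 := by
  rw [lineDeriv_lineDeriv hf, (eventually_differentiableAt hf).self_of_nhds.lineDeriv_eq_fderiv]
  set w := fderiv ℝ (fun y => fderiv ℝ f y e) x e with hw
  have hline : ∀ h : ℝ, HasDerivAt (fun t : ℝ => x + t • e) e h := fun h => by
    simpa using ((hasDerivAt_id h).smul_const e).const_add x
  have hcont : Tendsto (fun t : ℝ => x + t • e) (𝓝 0) (𝓝 x) := by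
    simpa using (hline 0).continuousAt.tendsto
  obtain ⟨r, hr, hball⟩ := Metric.eventually_nhds_iff_ball.1
    (hcont.eventually (eventually_differentiableAt hf))
  have hderiv : ∀ h ∈ Metric.ball (0 : ℝ) r,
      HasDerivWithinAt (fun h : ℝ => f (x + h • e) - (f x + h • fderiv ℝ f x e
        + ((1 / 2 : ℝ) * h ^ 2) • w)) (fderiv ℝ f (x + h • e) e - (fderiv ℝ f x e + h • w))
        (Metric.ball 0 r) h := by
    intro h hh
    have h1 := (hball h hh).hasFDerivAt.comp_hasDerivAt h (hline h)
    have h2 : HasDerivAt (fun h : ℝ => f x + h • fderiv ℝ f x e + ((1 / 2 : ℝ) * h ^ 2) • w)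
        (fderiv ℝ f x e + h • w) h := by
      have h3 := ((hasDerivAt_id h).smul_const (fderiv ℝ f x e)).const_add (f x)
      have h4 := (((hasDerivAt_id h).pow 2).const_mul (1 / 2 : ℝ)).smul_const w
      convert! h3.add h4 using 1
      simp
    exact (h1.sub h2).hasDerivWithinAt
  -- The derivative of the remainder is o(h), because the first derivative is itself differentiable
  -- at `x`; integrating on a convex ball gains one power of `h`.
  have hd : (fun h : ℝ => fderiv ℝ f (x + h • e) e - (fderiv ℝ f x e + h • w))
      =o[𝓝[Metric.ball 0 r] 0] fun h : ℝ => (h - 0) ^ 1 := by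
    have h1 : HasDerivAt (fun h : ℝ => fderiv ℝ f (x + h • e) e) w 0 := by
      have h2 : HasFDerivAt (fun y => fderiv ℝ f y e) (fderiv ℝ (fun y => fderiv ℝ f y e) x)
          (x + (0 : ℝ) • e) := by
        simpa using (differentiableAt_fderiv_apply hf e).hasFDerivAt
      exact h2.comp_hasDerivAt 0 (hline 0)
    refine (h1.isLittleO.mono nhdsWithin_le_nhds).congr (fun h => ?_) (fun h => by simp)
    simp [sub_sub]
  have := Convex.isLittleO_pow_succ_real (convex_ball (0 : ℝ) r) (Metric.mem_ball_self hr)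
    hderiv hd
  rw [nhdsWithin_eq_nhds.2 (Metric.ball_mem_nhds _ hr)] at this
  simpa using this

end Calculus

/-! ### Jacobian derivatives in terms of directional derivatives. -/

section Jacobian

variable {n m k : ℕ}

lemma jacobian_mulVec (f : EuclideanSpace ℝ (Fin n) → Fin k → ℝ)
    (x w : EuclideanSpace ℝ (Fin n)) : jacobian f x *ᵥ w.ofLp = fderiv ℝ f x w := by
  conv_rhs => rw [← (EuclideanSpace.basisFun (Fin n) ℝ).sum_repr w, map_sum]
  ext i
  simp [jacobian, Matrix.mulVec, dotProduct, mul_comm]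

/-- Right multiplication by a vector as a continuous linear map. -/
noncomputable def mulVecCLM (ξ : Fin k → ℝ) : Matrix (Fin m) (Fin k) ℝ →L[ℝ] (Fin m → ℝ) :=
  LinearMap.toContinuousLinearMap ((Matrix.mulVecBilin ℝ ℝ).flip ξ)

/-- The bilinear form `X ↦ ηᵀ X ξ` as a continuous linear map. -/
noncomputable def bilinCLM (η : Fin m → ℝ) (ξ : Fin k → ℝ) : Matrix (Fin m) (Fin k) ℝ →L[ℝ] ℝ :=
  (LinearMap.toContinuousLinearMap (dotProductBilin ℝ ℝ η)).comp (mulVecCLM ξ)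

lemma bilinCLM_apply (η : Fin m → ℝ) (ξ : Fin k → ℝ) (X : Matrix (Fin m) (Fin k) ℝ) :
    bilinCLM η ξ X = η ⬝ᵥ X *ᵥ ξ := rfl

variable {H : EuclideanSpace ℝ (Fin n) → Matrix (Fin m) (Fin k) ℝ} {x : EuclideanSpace ℝ (Fin n)}

lemma jacobianDeriv_mulVec (hH : DifferentiableAt ℝ H x) (ξ : Fin k → ℝ)
    (w : EuclideanSpace ℝ (Fin n)) :
    jacobianDeriv H ξ x *ᵥ w.ofLp = fderiv ℝ H x w *ᵥ ξ := by
  rw [jacobianDeriv, jacobian_mulVec]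
  have := ((mulVecCLM ξ).hasFDerivAt.comp x hH.hasFDerivAt).fderiv
  exact congrArg (fun L => L w) this

lemma dotProduct_jacobianDeriv_transpose (hH : ContDiffAt ℝ 2 H x) (η : Fin m → ℝ) (ξ : Fin k → ℝ)
    (w : EuclideanSpace ℝ (Fin n)) :
    (fun y => w.ofLp ⬝ᵥ (jacobianDeriv H ξ y)ᵀ *ᵥ η) =ᶠ[𝓝 x]
      fun y => bilinCLM η ξ (fderiv ℝ H y w) := by
  filter_upwards [eventually_differentiableAt hH] with y hy
  rw [bilinCLM_apply, ← jacobianDeriv_mulVec hy, Matrix.mulVec_transpose, dotProduct_comm,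
    Matrix.dotProduct_mulVec]

/-- With `w` frozen, the transposed Jacobian paired with `w` and `η` is the scalar `ηᵀ (D_w H) ξ`
near `x`; differentiating it in direction `e` identifies the nested Jacobian. -/
lemma dotProduct_jacobianDeriv_jacobianDeriv (hH : ContDiffAt ℝ 2 H x)
    (η : Fin m → ℝ) (ξ : Fin k → ℝ) (w e : EuclideanSpace ℝ (Fin n)) :
    w.ofLp ⬝ᵥ (jacobianDeriv (fun y => (jacobianDeriv H ξ y)ᵀ) η x *ᵥ e.ofLp)
      = η ⬝ᵥ (fderiv ℝ (fun y => fderiv ℝ H y w) x e *ᵥ ξ) := by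
  have hder : ∀ w : EuclideanSpace ℝ (Fin n),
      HasFDerivAt (fun y => w.ofLp ⬝ᵥ (jacobianDeriv H ξ y)ᵀ *ᵥ η)
        ((bilinCLM η ξ).comp (fderiv ℝ (fun y => fderiv ℝ H y w) x)) x := fun w =>
    ((bilinCLM η ξ).hasFDerivAt.comp x
      (differentiableAt_fderiv_apply hH w).hasFDerivAt).congr_of_eventuallyEq
      (dotProduct_jacobianDeriv_transpose hH η ξ w)
  -- Coordinates are the scalar functions above with `w` a basis vector.
  have hdiff : DifferentiableAt ℝ (fun y => (jacobianDeriv H ξ y)ᵀ *ᵥ η) x := by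
    rw [differentiableAt_pi]
    intro l
    simpa using (hder (EuclideanSpace.single l 1)).differentiableAt
  rw [jacobianDeriv, jacobian_mulVec]
  have h1 := (LinearMap.toContinuousLinearMap
    (dotProductBilin ℝ ℝ w.ofLp)).hasFDerivAt.comp x hdiff.hasFDerivAt
  exact congrArg (fun L => L e) (h1.unique (hder w))

/-- Transposition is linear and fixes `H` near `x`, so uniqueness of the derivative applies. This
symmetry lets `D_e H` move across the dot product in the Jacobian form. -/
lemma dirDeriv_isSymm {H : EuclideanSpace ℝ (Fin n) → Matrix (Fin m) (Fin m) ℝ}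
    (hH : DifferentiableAt ℝ H x) (hsymm : ∀ᶠ y in 𝓝 x, (H y).IsSymm)
    (e : EuclideanSpace ℝ (Fin n)) : (dirDeriv e H x).IsSymm := by
  have h1 := (LinearMap.toContinuousLinearMap (Matrix.transposeLinearEquiv (Fin m) (Fin m) ℝ ℝ :
    Matrix (Fin m) (Fin m) ℝ →ₗ[ℝ] Matrix (Fin m) (Fin m) ℝ)).hasFDerivAt.comp x hH.hasFDerivAt
  have h2 := hH.hasFDerivAt.unique (h1.congr_of_eventuallyEq (hsymm.mono fun y hy => hy.eq.symm))
  rw [Matrix.IsSymm, dirDeriv, hH.lineDeriv_eq_fderiv]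
  exact (congrArg (fun L => L e) h2).symm

end Jacobian

/-! ### The expansion for a matrix function along a line. -/

section Expansion

variable {n m : ℕ} {Ω : Set (EuclideanSpace ℝ (Fin n))}
  {H : EuclideanSpace ℝ (Fin n) → Matrix (Fin m) (Fin m) ℝ} {j : Fin m} {d : ℝ}
  {x : EuclideanSpace ℝ (Fin n)}

lemma tendsto_add_smul (x e : EuclideanSpace ℝ (Fin n)) :
    Tendsto (fun h : ℝ => x + h • e) (𝓝 0) (𝓝 x) := by
  have : Continuous fun h : ℝ => x + h • e := by fun_prop
  simpa using this.tendsto 0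

/-- `toEuclideanCLM` as a continuous linear map. -/
noncomputable def toOpCLM : Matrix (Fin m) (Fin m) ℝ →L[ℝ]
    (EuclideanSpace ℝ (Fin m) →L[ℝ] EuclideanSpace ℝ (Fin m)) :=
  LinearMap.toContinuousLinearMap
    (Matrix.toEuclideanCLM (n := Fin m) (𝕜 := ℝ)).toAlgEquiv.toLinearMap

/-- The second order expansion of `λ_j` along a line, tested on a unit eigenvector. -/
theorem eigval_expansion (hΩ : IsOpen Ω) (hsymm : ∀ x ∈ Ω, (H x).IsSymm)
    (hH : ContDiffOn ℝ 2 H Ω) (hd : ∀ x ∈ Ω, (eigproj (H x) j).trace = d)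
    (hx : x ∈ Ω) (e : EuclideanSpace ℝ (Fin n)) {ξ : EuclideanSpace ℝ (Fin m)}
    (hξ : ξ ∈ eigsp (H x) j) (hξ1 : ⟪ξ, ξ⟫ = 1) :
    (fun h : ℝ => eigval (H (x + h • e)) j - ⟪ξ, toOp (expansionMatrix H j x e h) ξ⟫)
      =o[𝓝 0] fun h : ℝ => h ^ 2 := by
  have hherm : ∀ y ∈ Ω, (H y).IsHermitian := fun y hy => by
    simpa [Matrix.IsHermitian, Matrix.IsSymm] using hsymm y hy
  have hHx : ContDiffAt ℝ 2 H x := hH.contDiffAt (hΩ.mem_nhds hx)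
  have hmem : ∀ᶠ h : ℝ in 𝓝 0, x + h • e ∈ Ω :=
    (tendsto_add_smul x e).eventually (hΩ.mem_nhds hx)
  have htaylor : (fun h : ℝ => toOp (H (x + h • e)) - (toOp (H x) + h • toOp (dirDeriv e H x)
      + ((1 / 2 : ℝ) * h ^ 2) • toOp (dirDeriv e (dirDeriv e H) x)))
      =o[𝓝 0] fun h : ℝ => h ^ 2 := by
    refine ((toOpCLM (m := m)).isBigO_comp _ _ |>.trans_isLittleO
      (taylor_two_line hHx e)).congr_left fun h => ?_
    change toOp (H (x + h • e) - (H x + h • dirDeriv e H x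
      + ((1 / 2 : ℝ) * h ^ 2) • dirDeriv e (dirDeriv e H) x)) = _
    simp only [toOp, map_sub, map_add, map_smul]
  have hlim : Tendsto (fun h : ℝ => eigval (H (x + h • e)) j) (𝓝 0) (𝓝 (eigval (H x) j)) := by
    have h1 : Tendsto (fun h : ℝ => ‖toOp (H (x + h • e)) - toOp (H x)‖) (𝓝 0) (𝓝 0) := by
      have h2 := ((toOpCLM (m := m)).continuous.continuousAt.comp hHx.continuousAt).tendsto.comp
        (tendsto_add_smul x e)
      exact tendsto_iff_norm_sub_tendsto_zero.1 h2
    rw [tendsto_iff_norm_sub_tendsto_zero]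
    refine squeeze_zero' (Eventually.of_forall fun h => norm_nonneg _) ?_ h1
    exact hmem.mono fun h hh => abs_eigval_sub_le (hherm _ hh) (hherm x hx) j
  have hdim : ∀ᶠ h : ℝ in 𝓝 0, Module.finrank ℝ (eigsp (H (x + h • e)) j)
      = Module.finrank ℝ (eigsp (H x) j) := hmem.mono fun h hh => by
    have := (hd _ hh).trans (hd x hx).symm
    rw [trace_eigproj, trace_eigproj] at this
    exact_mod_cast this
  refine (eigenvalue_expansion htaylor (Matrix.isSymmetric_toEuclideanLin_iff.2 (hherm x hx)) hlim
    (pseudoinv_apply_sub (hherm x hx) j) (fun v hv => pseudoinv_apply_eq_zero (hherm x hx) j hv)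
    hdim hξ hξ1).congr_left fun h => ?_
  simp only [expansionMatrix, toOp, map_add, map_smul, map_mul, map_one, _root_.add_apply,
    _root_.smul_apply, inner_add_right, inner_smul_right, one_apply_eq_self,
    mul_apply_eq_comp, hξ1, mul_one]

end Expansion

end EigenExpansion

/-! ### Eigenvector, Jacobian and trace forms. -/

theorem corollary5p1 {n m : ℕ} (Ω : Set (EuclideanSpace ℝ (Fin n))) (hΩ : IsOpen Ω)
    (H : EuclideanSpace ℝ (Fin n) → Matrix (Fin m) (Fin m) ℝ)
    (hsymm : ∀ x ∈ Ω, (H x).IsSymm) (hH : ContDiffOn ℝ 2 H Ω)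
    (j : Fin m) (d : ℝ) (hd : ∀ x ∈ Ω, (EigenExpansion.eigproj (H x) j).trace = d)
    (x : EuclideanSpace ℝ (Fin n)) (hx : x ∈ Ω) (e : EuclideanSpace ℝ (Fin n)) :
    (∀ ξ : Fin m → ℝ,
      ξ ∈ Set.range (fun η : Fin m → ℝ => EigenExpansion.eigproj (H x) j *ᵥ η) →
      ξ ⬝ᵥ ξ = 1 →
        ((fun h : ℝ => EigenExpansion.eigval (H (x + h • e)) j
            - ξ ⬝ᵥ (EigenExpansion.expansionMatrix H j x e h *ᵥ ξ))
          =o[𝓝 0] fun h : ℝ => h ^ 2) ∧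
        ((fun h : ℝ => EigenExpansion.eigval (H (x + h • e)) j
            - (EigenExpansion.eigval (H x) j
              + h * (ξ ⬝ᵥ (EigenExpansion.jacobianDeriv H ξ x *ᵥ e.ofLp))
              + (1 / 2 : ℝ) * h ^ 2 *
                (e.ofLp ⬝ᵥ
                  ((EigenExpansion.jacobianDeriv
                      (fun y => (EigenExpansion.jacobianDeriv H ξ y)ᵀ) ξ x
                    + (2 : ℝ) • ((EigenExpansion.jacobianDeriv H ξ x)ᵀ
                        * EigenExpansion.pseudoinv (H x) j
                        * EigenExpansion.jacobianDeriv H ξ x)) *ᵥ e.ofLp))))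
          =o[𝓝 0] fun h : ℝ => h ^ 2)) ∧
    ((fun h : ℝ => EigenExpansion.eigval (H (x + h • e)) j
        - (1 / d) * (EigenExpansion.eigproj (H x) j
            * EigenExpansion.expansionMatrix H j x e h).trace)
      =o[𝓝 0] fun h : ℝ => h ^ 2) := by
  open EigenExpansion in
  have hherm : (H x).IsHermitian := by
    simpa [Matrix.IsHermitian, Matrix.IsSymm] using hsymm x hx
  have hHx : ContDiffAt ℝ 2 H x := hH.contDiffAt (hΩ.mem_nhds hx)
  have hdiff : DifferentiableAt ℝ H x := hHx.differentiableAt (by simp)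
  refine ⟨fun ξ hξ hξ1 => ?_, ?_⟩
  · have hmem : WithLp.toLp 2 ξ ∈ eigsp (H x) j := by
      obtain ⟨η, rfl⟩ := hξ
      have h1 : WithLp.toLp 2 (eigproj (H x) j *ᵥ η)
          = (eigsp (H x) j).starProjection (WithLp.toLp 2 η) := by
        rw [← toOp_eigproj]
        rfl
      exact h1 ▸ Submodule.starProjection_apply_mem _ _
    have hfirst : (fun h : ℝ => eigval (H (x + h • e)) j
        - ξ ⬝ᵥ (expansionMatrix H j x e h *ᵥ ξ)) =o[𝓝 0] fun h : ℝ => h ^ 2 := by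
      refine (eigval_expansion hΩ hsymm hH hd hx e hmem ?_).congr_left fun h => ?_
      · rw [EuclideanSpace.inner_toLp_toLp]
        simpa using hξ1
      · rw [Matrix.inner_toEuclideanCLM]
    refine ⟨hfirst, hfirst.congr_left fun h => ?_⟩
    have hsymm' : (dirDeriv e H x)ᵀ = dirDeriv e H x :=
      dirDeriv_isSymm hdiff ((hΩ.mem_nhds hx |> Filter.eventually_of_mem) hsymm) e
    have h1 : jacobianDeriv H ξ x *ᵥ e.ofLp = dirDeriv e H x *ᵥ ξ := by
      rw [jacobianDeriv_mulVec hdiff, dirDeriv, hdiff.lineDeriv_eq_fderiv]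
      rfl
    have h2 : e.ofLp ⬝ᵥ (jacobianDeriv (fun y => (jacobianDeriv H ξ y)ᵀ) ξ x *ᵥ e.ofLp)
        = ξ ⬝ᵥ (dirDeriv e (dirDeriv e H) x *ᵥ ξ) := by
      rw [dotProduct_jacobianDeriv_jacobianDeriv hHx]
      exact congrArg (fun M => ξ ⬝ᵥ M *ᵥ ξ) (lineDeriv_lineDeriv hHx e).symm
    have h3 : e.ofLp ⬝ᵥ (((jacobianDeriv H ξ x)ᵀ * pseudoinv (H x) j * jacobianDeriv H ξ x)
        *ᵥ e.ofLp)
        = ξ ⬝ᵥ ((dirDeriv e H x * pseudoinv (H x) j * dirDeriv e H x) *ᵥ ξ) := by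
      simp only [← Matrix.mulVec_mulVec]
      rw [h1, Matrix.dotProduct_mulVec, Matrix.vecMul_transpose, h1, Matrix.dotProduct_mulVec ξ,
        ← Matrix.mulVec_transpose, hsymm']
    simp only [expansionMatrix, Matrix.add_mulVec, Matrix.smul_mulVec, dotProduct_add,
      dotProduct_smul, Matrix.one_mulVec, hξ1, h1, h2, h3, smul_eq_mul]
    ring
  · obtain ⟨b, hb⟩ := exists_eigenbasis hherm
    set s := Finset.univ.filter fun k => eigval (H x) j = eigval (H x) k with hs
    have hds : d = s.card := by rw [← hd x hx, trace_eigproj_eq_card hherm hb]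
    have hd0 : (s.card : ℝ) ≠ 0 := by
      rw [Nat.cast_ne_zero]
      exact Finset.card_ne_zero_of_mem (Finset.mem_filter.2 ⟨Finset.mem_univ j, rfl⟩)
    -- In an eigenbasis the projection keeps exactly the `d` vectors indexed by `s`, so the trace
    -- form is the mean of `d` eigenvector expansions.
    have htr : ∀ M : Matrix (Fin m) (Fin m) ℝ,
        (eigproj (H x) j * M).trace = ∑ k ∈ s, inner ℝ (b k) (toOp M (b k)) := by
      intro M
      rw [trace_eq_trace_toOp, LinearMap.trace_eq_sum_inner _ b, hs, Finset.sum_filter]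
      refine Finset.sum_congr rfl fun k _ => ?_
      have h1 : toOp (eigproj (H x) j * M) (b k)
          = (eigsp (H x) j).starProjection (toOp M (b k)) := by
        rw [← toOp_eigproj, toOp, map_mul]
        rfl
      rw [ContinuousLinearMap.coe_coe, h1, ← Submodule.inner_starProjection_left_eq_right,
        starProjection_eigenbasis hherm hb]
      split_ifs <;> simp
    have hsum : (fun h : ℝ => ∑ k ∈ s, (eigval (H (x + h • e)) j
        - inner ℝ (b k) (toOp (expansionMatrix H j x e h) (b k)))) =o[𝓝 0] fun h : ℝ => h ^ 2 := by
      refine IsLittleO.fun_sum fun k hk => eigval_expansion hΩ hsymm hH hd hx e ?_ ?_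
      · rw [mem_eigsp_iff, hb, (Finset.mem_filter.1 hk).2]
      · simp
    refine (hsum.const_mul_left (1 / d)).congr_left fun h => ?_
    rw [htr, Finset.sum_sub_distrib, Finset.sum_const, nsmul_eq_mul, mul_sub, hds,
      ← mul_assoc, one_div, inv_mul_cancel₀ hd0, one_mul]
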